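/- **Setting.** $|\cdot|$ is the Euclidean norm. A plant $\dot x=f(x,u,w)$, $y=g(x,w)$ has inputs in $\mathcal U\subset\mathbb R^{n_u}$, disturbances in $\mathcal W\subset\mathbb R^{n_w}$, and a steady-state map $p:\mathcal U\times\mathcal W\to\mathbb R^{n_x}$ with $f(p(u,w),u,w)=0$; put $h(u,w)=g(p(u,w),w)$. Given $G:\mathbb R^{n_z}\times\mathbb R^{n_y}\to\mathbb R^{n_z}$, a set-valued $\mathcal A:\mathbb R^{n_z}\rightrightarrows\mathbb R^{n_z}$ and $q:\mathbb R^{n_z}\to\mathcal U$, let $\mathbb G(z,w)=G(z,h(q(z),w))$ and $S(w)=\{z: 0\in\mathbb G(z,w)+\mathcal A(z)\}$. An algorithm is a map $T:\mathbb R^{n_z}\times\mathbb R^{n_y}\to\mathbb R^{n_z}$, with $\mathbb T(z,w)=T(z,h(q(z),w))$. An admissible disturbance is a $C^1$ signal $w:[0,\infty)\to\mathcal W$ with bounded $\dot w$. Class $\mathcal K$: continuous strictly increasing functions $[0,\infty)\to[0,\infty)$ vanishing at $0$; $\mathcal K_\infty$: unbounded ones; $\mathcal{KL}$: functions $\beta(r,s)$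 with $\beta(\cdot,s)\in\mathcal K$ for all $s\ge0$ and $\beta(r,\cdot)$ continuous, strictly decreasing and tending to $0$ for all $r>0$. **Assumptions.** 1. *(Plant)* $f$ is locally Lipschitz, $g$ is globally Lipschitz, $\mathcal U$ and $\mathcal W$ are compact and convex, and there are a $C^1$ function $V(x,u,w)$, constants $\epsilon_x,\epsilon_w,\alpha_3,\alpha_4,\alpha_5>0$ and $\sigma_1\in\mathcal K$ such that for every constant $u\in\mathcal U$, every admissible $w$ and every solution $x$ of the plant (on any time interval), $\alpha_3|x-p(u,w)|^2\le V(x,u,w)\le\alpha_4|x-p(u,w)|^2$ wherever $V\le\epsilon_x$, and $\dot V(x(t),u,w(t))\le-\alpha_5V(x(t),u,w(t))+\sigma_1(|\dot w(t)|)$ whenever $V(x(t),u,w(t))\le\epsilon_x$ and $|\dot w(t)|\le\epsilon_w$. 2. *(Regularity)* $q$ is globally Lipschitz, $G$ is $C^1$, and for all $w\in\mathcal W$ and $z\in S(w)$ the map $\mathbb G(\cdot,w)+\mathcal A(\cdot)$ is strongly regular at $(z,0)$: its inverse, truncated to some neighbourhoods of $0$ and $z$, is a single-valued Lipschitz function.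 3. *(Algorithm)* (i) For $w\in\mathcal W$: $z=\mathbb T(z,w)\iff z\in S(w)$. (ii) There are a continuous $W:\mathbb R^{n_z}\times\mathcal W\to\mathbb R$, $\epsilon>0$, $\alpha_1,\alpha_2\in\mathcal K_\infty$ and $\alpha\in\mathcal K$ such that for all $w\in\mathcal W$, $\bar z\in S(w)$ and $|z-\bar z|\le\epsilon$, $$\alpha_1(|z-\bar z|)\le W(z,w)\le\alpha_2(|z-\bar z|),\qquad W(\mathbb T(z,w),w)\le W(z,w)-\alpha(|z-\bar z|).$$ (iii) For every bounded $B\subset\mathbb R^{n_z}$ there is $L_T$ such that $T(z,\cdot)$ is $L_T$-Lipschitz for all $z\in B$. (iv) $\mathbb T(\cdot,w)$ is continuous at its fixed points, uniformly over them and over $w$: for every $\eta>0$ there is $\rho>0$ such that $|\mathbb T(z,w)-\bar z|\le\eta$ for all $w\in\mathcal W$, $\bar z\in S(w)$, $|z-\bar z|\le\rho$. **Error dynamics.** Let $\bar z:\mathcal W\to\mathbb R^{n_z}$ be a branch of solutions, i.e. continuous with $\bar z(w)\in S(w)$ for all $w\in\mathcal W$. For a sampling period $\tau>0$ and an admissible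 $w$ put $t^k=k\tau$, $w^k=w(t^k)$, and $d^k=\operatorname{ess\,sup}_{t\in[t^k,t^{k+1}]}|\dot w(t)|$. For an arbitrary plant transient sequence $(\delta x^k)$, the algorithm error dynamics with state $e^k$ and output $\Delta u^k$ are, with $z^k=e^k+\bar z(w^k)$, $u^k=q(z^k)$, $x^k=\delta x^k+p(u^k,w^k)$, $$\hat T^k=T\bigl(z^k,\,g(\psi^k,w^{k+1})\bigr),\qquad e^{k+1}=\hat T^k-\bar z(w^{k+1}),\qquad \Delta u^k=q(\hat T^k)-q(z^k),$$ where $\psi^k$ is the value at $t^{k+1}$ of the solution of $\dot\xi=f(\xi,u^k,w(t))$, $\xi(t^k)=x^k$. Put $V^k=V(x^k,u^k,w^k)$, $W^k=W(z^k,w^k)$, $\|V\|=\sup_kV^k$, $\|d\|=\sup_kd^k$. **Theorem.** Under Assumptions 1–3, for every branch $\bar z$ the algorithm error dynamics are locally input-output stable: there exist $\bar\varepsilon_1,\bar\varepsilon_2>0$, $\beta_z,\beta_u\in\mathcal{KL}$, $\gamma_z^x,\gamma_u^x\in\mathcal{KL}$ and $\gamma_z^d,\gamma_u^d\in\mathcal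 K$, independent of $\tau$, $w$ and the trajectory, such that for every $\tau>0$ there is $\bar\varepsilon_3>0$ such that, for every admissible $w$ and every trajectory of the error dynamics with $|e^0|\le\epsilon$, $W^0\le\bar\varepsilon_1$, $\|V\|\le\bar\varepsilon_2$ and $\|d\|\le\bar\varepsilon_3$, for all $k\ge0$ $$W^k\le\beta_z(W^0,k)+\gamma_z^x(\|V\|,\tau)+\gamma_z^d(\|d\|),\qquad |\Delta u^k|\le\beta_u(W^0,k)+\gamma_u^x(\|V\|,\tau)+\gamma_u^d(\|d\|).$$ -/

import Mathlib

open Set Filter Topology MeasureTheory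

noncomputable section

namespace FES

/-- Euclidean space of dimension `n`, with the Euclidean norm. -/
abbrev Vec (n : ℕ) := EuclideanSpace ℝ (Fin n)

/-! ### Comparison functions -/

/-- Class `K`: functions on `[0, ∞)` that are continuous, strictly increasing and vanish at `0`
(only the values on `[0, ∞)` matter). -/
structure IsClassK (γ : ℝ → ℝ) : Prop where
  continuousOn : ContinuousOn γ (Ici 0)
  strictMonoOn : StrictMonoOn γ (Ici 0)
  map_zero : γ 0 = 0

/-- Class `K∞`: unbounded class `K` functions. -/
structure IsClassKInfty (γ : ℝ → ℝ) : Prop extends IsClassK γ where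
  tendsto_atTop : Tendsto γ atTop atTop

/-- Class `L`: nonnegative functions on `[0, ∞)` that are continuous, strictly decreasing and
tend to `0` at infinity. -/
structure IsClassL (σ : ℝ → ℝ) : Prop where
  nonneg : ∀ s, 0 ≤ s → 0 ≤ σ s
  continuousOn : ContinuousOn σ (Ici 0)
  strictAntiOn : StrictAntiOn σ (Ici 0)
  tendsto_zero : Tendsto σ atTop (𝓝 0)

/-- Class `KL`: `β(·, s)` is of class `K` for every `s ≥ 0`, and `β(r, ·)` is of class `L` for
every `r > 0`.  (At `r = 0` one has `β(0, ·) = 0`.) -/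
structure IsClassKL (β : ℝ → ℝ → ℝ) : Prop where
  classK : ∀ s, 0 ≤ s → IsClassK (fun r => β r s)
  classL : ∀ r, 0 < r → IsClassL (fun s => β r s)

/-! ### Strong regularity -/

/-- A set-valued map `Ψ` is strongly regular at `(x, y)` if `y ∈ Ψ x` and, for some neighbourhoods
`N` of `x` and `M` of `y`, the truncated inverse `v ↦ Ψ⁻¹(v) ∩ N` is a (single-valued)
Lipschitz function on `M`. -/
def StronglyRegularAt {n : ℕ} (Ψ : Vec n → Set (Vec n)) (x y : Vec n) : Prop :=
  y ∈ Ψ x ∧ ∃ N ∈ 𝓝 x, ∃ M ∈ 𝓝 y, ∃ φ : Vec n → Vec n, ∃ K : NNReal,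
    (∀ v ∈ M, {x' | v ∈ Ψ x'} ∩ N = {φ v}) ∧ LipschitzOnWith K φ M

/-! ### Signals and the plant -/

/-- The time derivative on `[0, ∞)` (one-sided at `0`). -/
def dot {n : ℕ} (w : ℝ → Vec n) (t : ℝ) : Vec n := derivWithin w (Ici 0) t

/-- Admissible disturbance signals: continuously differentiable on `[0, ∞)`, with values in `𝒲`
and with a bounded derivative. -/
structure IsDisturbance {n : ℕ} (𝒲 : Set (Vec n)) (w : ℝ → Vec n) : Prop where
  contDiffOn : ContDiffOn ℝ 1 w (Ici 0)
  mem : ∀ t, 0 ≤ t → w t ∈ 𝒲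
  bddAbove : BddAbove ((fun t => ‖dot w t‖) '' Ici 0)

/-- `d^k`, the essential supremum of `|ẇ(t)|` over the `k`-th sampling interval
`[kτ, (k+1)τ]`. -/
def dSeq {n : ℕ} (w : ℝ → Vec n) (τ : ℝ) (k : ℕ) : ℝ :=
  essSup (fun t => ‖dot w t‖) (volume.restrict (Icc ((k : ℝ) * τ) (((k : ℝ) + 1) * τ)))

/-- The data of the problem: a plant `ẋ = f(x,u,w)`, `y = g(x,w)` with input set `𝒰`, disturbance
set `𝒲` and steady-state map `p`; a generalized equation `0 ∈ G(z,s) + A(z)`, `s = h(u,w)`,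
`u = q(z)`; and an algorithm `T`.  (Pure data; the hypotheses are stated separately.) -/
structure Data (nx ny nu nw nz : ℕ) where
  f : Vec nx → Vec nu → Vec nw → Vec nx
  g : Vec nx → Vec nw → Vec ny
  𝒰 : Set (Vec nu)
  𝒲 : Set (Vec nw)
  p : Vec nu → Vec nw → Vec nx
  G : Vec nz → Vec ny → Vec nz
  A : Vec nz → Set (Vec nz)
  q : Vec nz → Vec nu
  T : Vec nz → Vec ny → Vec nz

namespace Data

variable {nx ny nu nw nz : ℕ} (D : Data nx ny nu nw nz)

/-- The steady-state input-output map `h(u,w) = g(p(u,w),w)`. -/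
def h (u : Vec nu) (w : Vec nw) : Vec ny := D.g (D.p u w) w

/-- The condensed mapping `𝔾(z,w) = G(z, h(q(z),w))`. -/
def GG (z : Vec nz) (w : Vec nw) : Vec nz := D.G z (D.h (D.q z) w)

/-- The set-valued mapping `z ↦ 𝔾(z,w) + A(z)`. -/
def GE (w : Vec nw) (z : Vec nz) : Set (Vec nz) := {v | ∃ a ∈ D.A z, v = D.GG z w + a}

/-- The solution mapping `S(w) = {z | 0 ∈ 𝔾(z,w) + A(z)}`. -/
def S (w : Vec nw) : Set (Vec nz) := {z | (0 : Vec nz) ∈ D.GE w z}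

/-- The condensed algorithm `𝕋(z,w) = T(z, h(q(z),w))`. -/
def TT (z : Vec nz) (w : Vec nw) : Vec nz := D.T z (D.h (D.q z) w)

/-- `x` solves `ẋ(t) = f(x(t), u, w(t))` on `[a,b]` for the constant input `u`. -/
def IsPlantSolution (w : ℝ → Vec nw) (u : Vec nu) (a b : ℝ) (x : ℝ → Vec nx) : Prop :=
  ∀ t ∈ Icc a b, HasDerivWithinAt x (D.f (x t) u (w t)) (Icc a b) t

/-- `ξ⁺ = ψ(ξ, u, w)`: the solution of the plant equation on `[a,b]` that starts at `ξ` at time `a`,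
with constant input `u`, is at `ξ⁺` at time `b`. -/
def PlantStep (w : ℝ → Vec nw) (u : Vec nu) (a b : ℝ) (ξ ξ' : Vec nx) : Prop :=
  ∃ x : ℝ → Vec nx, D.IsPlantSolution w u a b x ∧ x a = ξ ∧ x b = ξ'

/-- `V` is a local input-to-state Lyapunov function of the plant, for constant inputs `u ∈ 𝒰`. -/
def IsLISSLyapunov (V : Vec nx → Vec nu → Vec nw → ℝ) : Prop :=
  ContDiffOn ℝ 1 (fun m : Vec nx × Vec nu × Vec nw => V m.1 m.2.1 m.2.2)
    (univ ×ˢ (D.𝒰 ×ˢ D.𝒲)) ∧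
  ∃ εx > 0, ∃ εw > 0, ∃ α₃ > 0, ∃ α₄ > 0, ∃ α₅ > 0, ∃ σ₁ : ℝ → ℝ, IsClassK σ₁ ∧
    (∀ x, ∀ u ∈ D.𝒰, ∀ w ∈ D.𝒲, V x u w ≤ εx →
      α₃ * ‖x - D.p u w‖ ^ 2 ≤ V x u w ∧ V x u w ≤ α₄ * ‖x - D.p u w‖ ^ 2) ∧
    (∀ u ∈ D.𝒰, ∀ w : ℝ → Vec nw, IsDisturbance D.𝒲 w →
      ∀ a b : ℝ, 0 ≤ a → a < b → ∀ x : ℝ → Vec nx, D.IsPlantSolution w u a b x →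
      ∀ t ∈ Icc a b, V (x t) u (w t) ≤ εx → ‖dot w t‖ ≤ εw →
        derivWithin (fun s => V (x s) u (w s)) (Icc a b) t
          ≤ -α₅ * V (x t) u (w t) + σ₁ ‖dot w t‖)

/-- Robust stability of the plant, with local ISS Lyapunov function `V`. -/
structure PlantAssumption (V : Vec nx → Vec nu → Vec nw → ℝ) : Prop where
  f_locallyLipschitz : LocallyLipschitzOn (univ ×ˢ (D.𝒰 ×ˢ D.𝒲))
    (fun m : Vec nx × Vec nu × Vec nw => D.f m.1 m.2.1 m.2.2)
  g_lipschitz : ∃ L : NNReal, LipschitzOnWith L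
    (fun m : Vec nx × Vec nw => D.g m.1 m.2) (univ ×ˢ D.𝒲)
  inputs_compact : IsCompact D.𝒰
  inputs_convex : Convex ℝ D.𝒰
  disturbances_compact : IsCompact D.𝒲
  disturbances_convex : Convex ℝ D.𝒲
  steadyState : ∀ u ∈ D.𝒰, ∀ w ∈ D.𝒲, D.f (D.p u w) u w = 0
  liss : D.IsLISSLyapunov V

/-- Strong regularity of the generalized equation. -/
structure RegularityAssumption : Prop where
  q_mem : ∀ z, D.q z ∈ D.𝒰
  q_lipschitz : ∃ L : NNReal, LipschitzWith L D.q
  G_contDiff : ContDiff ℝ 1 (fun m : Vec nz × Vec ny => D.G m.1 m.2)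
  stronglyRegular : ∀ w ∈ D.𝒲, ∀ z ∈ D.S w, StronglyRegularAt (D.GE w) z 0

/-- Robust convergence of the algorithm, with merit function `W` on the `ε`-neighbourhoods of the
solutions. -/
structure AlgorithmAssumption (W : Vec nz → Vec nw → ℝ) (ε : ℝ) : Prop where
  fixedPoints : ∀ w ∈ D.𝒲, ∀ z, z = D.TT z w ↔ z ∈ D.S w
  W_continuous : ContinuousOn (fun m : Vec nz × Vec nw => W m.1 m.2) (univ ×ˢ D.𝒲)
  ε_pos : 0 < ε
  merit : ∃ α₁ α₂ α : ℝ → ℝ, IsClassKInfty α₁ ∧ IsClassKInfty α₂ ∧ IsClassK α ∧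
    ∀ w ∈ D.𝒲, ∀ zbar ∈ D.S w, ∀ z, ‖z - zbar‖ ≤ ε →
      α₁ ‖z - zbar‖ ≤ W z w ∧ W z w ≤ α₂ ‖z - zbar‖ ∧
      W (D.TT z w) w ≤ W z w - α ‖z - zbar‖
  /-- `T` is Lipschitz in `s`, locally uniformly in `z`. -/
  T_lipschitz : ∀ B : Set (Vec nz), Bornology.IsBounded B →
    ∃ L : NNReal, ∀ z ∈ B, LipschitzWith L (D.T z)
  /-- `𝕋(·,w)` is continuous at its fixed points, uniformly over them and over `w ∈ 𝒲`. -/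
  TT_continuous_at_solutions : ∀ η > 0, ∃ ρ > 0, ∀ w ∈ D.𝒲, ∀ zbar ∈ D.S w, ∀ z,
    ‖z - zbar‖ ≤ ρ → ‖D.TT z w - zbar‖ ≤ η

/-- A branch of solutions: a continuous selection of `S` over `𝒲`. -/
structure IsBranch (zbar : Vec nw → Vec nz) : Prop where
  continuousOn : ContinuousOn zbar D.𝒲
  mem : ∀ w ∈ D.𝒲, zbar w ∈ D.S w

/-! ### The sampled error dynamics of the algorithm about a branch -/

/-- `z^k = e^k + zbar(w^k)`, where `w^k = w(kτ)`. -/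
def zSeq (zbar : Vec nw → Vec nz) (w : ℝ → Vec nw) (τ : ℝ) (e : ℕ → Vec nz) (k : ℕ) : Vec nz :=
  e k + zbar (w ((k : ℝ) * τ))

/-- `u^k = q(z^k)`. -/
def uSeq (zbar : Vec nw → Vec nz) (w : ℝ → Vec nw) (τ : ℝ) (e : ℕ → Vec nz) (k : ℕ) : Vec nu :=
  D.q (zSeq zbar w τ e k)

/-- `x^k = δx^k + p(u^k, w^k)`. -/
def xSeq (zbar : Vec nw → Vec nz) (w : ℝ → Vec nw) (τ : ℝ) (e : ℕ → Vec nz) (δx : ℕ → Vec nx)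
    (k : ℕ) : Vec nx :=
  δx k + D.p (D.uSeq zbar w τ e k) (w ((k : ℝ) * τ))

/-- `V^k = V(x^k, u^k, w^k)`. -/
def VSeq (V : Vec nx → Vec nu → Vec nw → ℝ) (zbar : Vec nw → Vec nz) (w : ℝ → Vec nw) (τ : ℝ)
    (e : ℕ → Vec nz) (δx : ℕ → Vec nx) (k : ℕ) : ℝ :=
  V (D.xSeq zbar w τ e δx k) (D.uSeq zbar w τ e k) (w ((k : ℝ) * τ))

/-- `W^k = W(z^k, w^k)`. -/
def WSeq (W : Vec nz → Vec nw → ℝ) (zbar : Vec nw → Vec nz) (w : ℝ → Vec nw) (τ : ℝ)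
    (e : ℕ → Vec nz) (k : ℕ) : ℝ :=
  W (zSeq zbar w τ e k) (w ((k : ℝ) * τ))

/-- The error dynamics of the algorithm about the branch `zbar`, with state `e`, inputs `δx` and
`w`, and output `Δu`: with `x⁺ = ψ(x^k, u^k, w)` the plant state reached at time `(k+1)τ` and
`T̂ = T(z^k, g(x⁺, w^{k+1}))`, one has `e^{k+1} = T̂ - zbar(w^{k+1})` and
`Δu^k = q(T̂) - q(z^k)`.  The sequence `δx` is an exogenous input. -/
def IsErrorTrajectory (zbar : Vec nw → Vec nz) (w : ℝ → Vec nw) (τ : ℝ)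
    (e : ℕ → Vec nz) (δx : ℕ → Vec nx) (Δu : ℕ → Vec nu) : Prop :=
  ∀ k : ℕ, ∃ x' : Vec nx,
    D.PlantStep w (D.uSeq zbar w τ e k) ((k : ℝ) * τ) (((k : ℝ) + 1) * τ)
      (D.xSeq zbar w τ e δx k) x' ∧
    e (k + 1) = D.T (zSeq zbar w τ e k) (D.g x' (w (((k : ℝ) + 1) * τ)))
      - zbar (w (((k : ℝ) + 1) * τ)) ∧
    Δu k = D.q (D.T (zSeq zbar w τ e k) (D.g x' (w (((k : ℝ) + 1) * τ))))
      - D.q (zSeq zbar w τ e k)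

end Data

end FES

end

/-! The merit function `W` is an input-to-state Lyapunov function for the error recursion. With the
plant at steady state and the disturbance frozen, one iteration lowers `W` by `α`. In reality the
measured output is off its steady-state value and the solution moves from `zbar (w^k)` to `zbar
(w^{k+1})`. Uniform continuity of `W` on a compact tube around the branch turns both effects into
additive class K errors, so that W^{k+1} ≤ W^k - κ(W^k) + r (`exists_robust_decrease`). The output
error is controlled by the exponential decay of `V` over a sampling interval, whence the class KL
dependence on `τ` (`exists_perturbation_bound`).

Everything is local: the thresholds are such that r cannot push W out of the sublevel set {W ≤ ε₁},
on which |e| ≤ ρ. A scalar comparison (`IsClassKInfty.exists_iss`) then bounds W^k. The output bound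
follows from T̂ - z^k = e^{k+1} - e^k + zbar(w^{k+1}) - zbar(w^k) and |e| ≤ α₁⁻¹(W).

The disturbance gains are free of `τ` although w may move by τ‖d‖ in one period: once ‖d‖ ≤ 1/τ²,
this is at most √‖d‖, so `τ` enters only the threshold on ‖d‖. -/

namespace FES

/-! ### Calculus of comparison functions -/

namespace IsClassK

variable {f g : ℝ → ℝ}

theorem monotoneOn (hf : IsClassK f) : MonotoneOn f (Ici 0) := hf.strictMonoOn.monotoneOn

theorem mono (hf : IsClassK f) {x y : ℝ} (hx : 0 ≤ x) (hxy : x ≤ y) : f x ≤ f y :=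
  hf.monotoneOn hx (hx.trans hxy) hxy

theorem nonneg (hf : IsClassK f) {x : ℝ} (hx : 0 ≤ x) : 0 ≤ f x :=
  hf.map_zero ▸ hf.mono le_rfl hx

theorem pos (hf : IsClassK f) {x : ℝ} (hx : 0 < x) : 0 < f x := by
  have := hf.strictMonoOn (mem_Ici.2 le_rfl) (mem_Ici.2 hx.le) hx
  rwa [hf.map_zero] at this

theorem le_of_le (hf : IsClassK f) {x y : ℝ} (hx : 0 ≤ x) (hy : 0 ≤ y) (h : f x ≤ f y) : x ≤ y :=
  (hf.strictMonoOn.le_iff_le (mem_Ici.2 hx) (mem_Ici.2 hy)).1 h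

theorem mapsTo (hf : IsClassK f) : MapsTo f (Ici 0) (Ici 0) := fun _ hx => hf.nonneg hx

theorem comp (hf : IsClassK f) (hg : IsClassK g) : IsClassK (fun x => f (g x)) where
  continuousOn := hf.continuousOn.comp hg.continuousOn hg.mapsTo
  strictMonoOn := hf.strictMonoOn.comp hg.strictMonoOn hg.mapsTo
  map_zero := by simp [hg.map_zero, hf.map_zero]

theorem add (hf : IsClassK f) (hg : IsClassK g) : IsClassK (fun x => f x + g x) where
  continuousOn := hf.continuousOn.add hg.continuousOn
  strictMonoOn := fun _ hx _ hy h =>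
    add_lt_add (hf.strictMonoOn hx hy h) (hg.strictMonoOn hx hy h)
  map_zero := by simp [hg.map_zero, hf.map_zero]

theorem const_mul {c : ℝ} (hc : 0 < c) (hf : IsClassK f) : IsClassK (fun x => c * f x) where
  continuousOn := continuousOn_const.mul hf.continuousOn
  strictMonoOn := fun _ hx _ hy h => mul_lt_mul_of_pos_left (hf.strictMonoOn hx hy h) hc
  map_zero := by simp [hf.map_zero]

theorem id : IsClassK (fun x => x) where
  continuousOn := continuousOn_id
  strictMonoOn := fun _ _ _ _ h => h
  map_zero := rfl

theorem sqrt : IsClassK Real.sqrt where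
  continuousOn := Real.continuous_sqrt.continuousOn
  strictMonoOn := fun _ hx _ _ h => Real.sqrt_lt_sqrt hx h
  map_zero := Real.sqrt_zero

/-- Weak triangle inequality: a sum is at most twice its larger term. -/
theorem apply_add_le (hf : IsClassK f) {a b : ℝ} (ha : 0 ≤ a) (hb : 0 ≤ b) :
    f (a + b) ≤ f (2 * a) + f (2 * b) := by
  rcases le_total a b with h | h
  · have h1 := hf.mono (add_nonneg ha hb) (by linarith : a + b ≤ 2 * b)
    have h2 := hf.nonneg (by linarith : (0 : ℝ) ≤ 2 * a)
    linarith
  · have h1 := hf.mono (add_nonneg ha hb) (by linarith : a + b ≤ 2 * a)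
    have h2 := hf.nonneg (by linarith : (0 : ℝ) ≤ 2 * b)
    linarith

theorem tendsto_zero (hf : IsClassK f) : Tendsto f (𝓝[≥] 0) (𝓝 0) := by
  have := hf.continuousOn 0 (mem_Ici.2 le_rfl)
  rwa [ContinuousWithinAt, hf.map_zero] at this

theorem exists_pos_le (hf : IsClassK f) {η : ℝ} (hη : 0 < η) : ∃ δ > 0, f δ ≤ η := by
  have h1 : ∀ᶠ x in 𝓝[>] (0 : ℝ), f x < η :=
    (hf.tendsto_zero.mono_left (nhdsWithin_mono _ Ioi_subset_Ici_self)).eventually_lt_const hη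
  obtain ⟨x, hx, hx0⟩ := (h1.and self_mem_nhdsWithin).exists
  exact ⟨x, hx0, hx.le⟩

/-- A class `K` function agrees on any bounded interval with a class `K∞` function. -/
theorem exists_classKInfty_eqOn (hf : IsClassK f) {c : ℝ} (hc : 0 ≤ c) :
    ∃ F : ℝ → ℝ, IsClassKInfty F ∧ ∀ x ∈ Icc 0 c, F x = f x := by
  -- `f` is frozen beyond `c` and continued with slope one.
  refine ⟨fun x => f (min x c) + max (x - c) 0, ⟨⟨?_, ?_, ?_⟩, ?_⟩, ?_⟩
  · refine ContinuousOn.add (hf.continuousOn.comp (by fun_prop) fun x hx => ?_) (by fun_prop)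
    exact mem_Ici.2 (le_min hx hc)
  · intro x hx y hy hxy
    rcases lt_or_ge x c with h | h
    · have h1 := hf.strictMonoOn (mem_Ici.2 (le_min hx hc)) (mem_Ici.2 (le_min hy hc))
        (show min x c < min y c by rw [min_eq_left h.le]; exact lt_min hxy h)
      have h2 : max (x - c) 0 ≤ max (y - c) 0 := max_le_max (by linarith) le_rfl
      exact add_lt_add_of_lt_of_le h1 h2
    · have hy' : c ≤ y := h.trans hxy.le
      simp only [min_eq_right h, min_eq_right hy', max_eq_left (sub_nonneg.2 h),
        max_eq_left (sub_nonneg.2 hy')]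
      linarith
  · simp [hc, hf.map_zero]
  · refine tendsto_atTop_mono' atTop (f₁ := fun x => x - c) ?_
      (tendsto_atTop_add_const_right _ _ tendsto_id)
    filter_upwards [eventually_ge_atTop 0] with x hx
    have := hf.nonneg (le_min hx hc)
    have := le_max_left (x - c) 0
    linarith
  · rintro x ⟨-, hx⟩
    simp [hx]

end IsClassK

/-- A strictly increasing map of `[0, ∞)` onto itself is of class `K`. -/
theorem isClassK_of_surjOn {f : ℝ → ℝ} (hmono : StrictMonoOn f (Ici 0)) (h0 : f 0 = 0)
    (hsurj : SurjOn f (Ici 0) (Ici 0)) : IsClassK f := by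
  refine ⟨?_, hmono, h0⟩
  have hpos : ∀ x, 0 ≤ x → 0 ≤ f x := fun x hx =>
    h0 ▸ hmono.monotoneOn (mem_Ici.2 le_rfl) (mem_Ici.2 hx) hx
  -- Extended by the identity to negative reals, `f` becomes a monotone surjection of the line,
  -- hence continuous.
  have hF : Monotone (fun x => if x < 0 then x else f x) := by
    intro x y hxy
    dsimp only
    split_ifs with hx hy hy
    · exact hxy
    · exact hx.le.trans (hpos y (not_lt.1 hy))
    · exact absurd (hxy.trans_lt hy) hx
    · exact hmono.monotoneOn (mem_Ici.2 (not_lt.1 hx)) (mem_Ici.2 (not_lt.1 hy)) hxy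
  have hS : Function.Surjective (fun x => if x < 0 then x else f x) := by
    intro y
    rcases lt_or_ge y 0 with hy | hy
    · exact ⟨y, by simp [hy]⟩
    · obtain ⟨x, hx, hxy⟩ := hsurj hy
      exact ⟨x, by simp [not_lt.2 (mem_Ici.1 hx), hxy]⟩
  exact (hF.continuous_of_surjective hS).continuousOn.congr fun x hx => by
    simp [not_lt.2 (mem_Ici.1 hx)]

theorem IsClassKInfty.surjOn {f : ℝ → ℝ} (hf : IsClassKInfty f) : SurjOn f (Ici 0) (Ici 0) := by
  intro y hy
  obtain ⟨b, hb, hb0⟩ :=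
    ((hf.tendsto_atTop.eventually_ge_atTop y).and (eventually_ge_atTop 0)).exists
  obtain ⟨x, hx, hxy⟩ := intermediate_value_Icc hb0
    (hf.continuousOn.mono Icc_subset_Ici_self) ⟨by rw [hf.map_zero]; exact hy, hb⟩
  exact ⟨x, hx.1, hxy⟩

theorem IsClassKInfty.exists_inverse {f : ℝ → ℝ} (hf : IsClassKInfty f) :
    ∃ g : ℝ → ℝ, IsClassKInfty g ∧ (∀ x, 0 ≤ x → g (f x) = x) ∧ ∀ y, 0 ≤ y → f (g y) = y := by
  have hK := hf.toIsClassK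
  have hs : ∀ y, 0 ≤ y → ∃ x, 0 ≤ x ∧ f x = y := fun y hy => hf.surjOn hy
  choose! g hg hfg using hs
  have hgf : ∀ x, 0 ≤ x → g (f x) = x := fun x hx =>
    hf.strictMonoOn.injOn (hg _ (hK.nonneg hx)) hx (hfg _ (hK.nonneg hx))
  have hmono : StrictMonoOn g (Ici 0) := fun x hx y hy hxy => by
    by_contra h
    have := hK.mono (hg y hy) (not_lt.1 h)
    rw [hfg x hx, hfg y hy] at this
    exact absurd hxy (not_lt.2 this)
  refine ⟨g, ⟨isClassK_of_surjOn hmono ?_ fun x hx => ⟨f x, hK.nonneg hx, hgf x hx⟩, ?_⟩, hgf,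
    hfg⟩
  · simpa [hf.map_zero] using hgf 0 le_rfl
  · refine Filter.tendsto_atTop.2 fun b => ?_
    filter_upwards [eventually_ge_atTop (f (max b 0))] with y hy
    have hy0 : 0 ≤ y := (hK.nonneg (le_max_right _ _)).trans hy
    have := hmono.monotoneOn (hK.nonneg (le_max_right b 0)) hy0 hy
    rw [hgf _ (le_max_right _ _)] at this
    exact (le_max_left _ _).trans this

theorem IsClassKInfty.comp {f g : ℝ → ℝ} (hf : IsClassKInfty f) (hg : IsClassKInfty g) :
    IsClassKInfty (fun x => f (g x)) :=
  ⟨hf.toIsClassK.comp hg.toIsClassK, hf.tendsto_atTop.comp hg.tendsto_atTop⟩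

theorem IsClassKInfty.const_mul {f : ℝ → ℝ} {c : ℝ} (hc : 0 < c) (hf : IsClassKInfty f) :
    IsClassKInfty (fun x => c * f x) :=
  ⟨hf.toIsClassK.const_mul hc, hf.tendsto_atTop.const_mul_atTop hc⟩

theorem IsClassK.apply_add₃_le {f : ℝ → ℝ} (hf : IsClassK f) {a b c : ℝ} (ha : 0 ≤ a)
    (hb : 0 ≤ b) (hc : 0 ≤ c) : f (a + b + c) ≤ f (4 * a) + f (4 * b) + f (2 * c) := by
  have h1 := hf.apply_add_le (add_nonneg ha hb) hc
  have h2 := hf.apply_add_le (mul_nonneg zero_le_two ha) (mul_nonneg zero_le_two hb)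
  rw [show 2 * (2 * a) = 4 * a by ring, show 2 * (2 * b) = 4 * b by ring] at h2
  rw [show 2 * (a + b) = 2 * a + 2 * b by ring] at h1
  linarith

theorem IsClassK.comp_classKL {γ : ℝ → ℝ} {β : ℝ → ℝ → ℝ} (hγ : IsClassK γ) (hβ : IsClassKL β) :
    IsClassKL (fun r s => γ (β r s)) where
  classK := fun s hs => hγ.comp (hβ.classK s hs)
  classL := fun r hr => by
    have h := hβ.classL r hr
    have hm : MapsTo (β r) (Ici 0) (Ici 0) := fun s hs => h.nonneg s hs
    refine ⟨fun s hs => hγ.nonneg (h.nonneg s hs), hγ.continuousOn.comp h.continuousOn hm,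
      fun x hx y hy hxy => hγ.strictMonoOn (hm hy) (hm hx) (h.strictAntiOn hx hy hxy), ?_⟩
    refine hγ.tendsto_zero.comp (tendsto_nhdsWithin_iff.2 ⟨h.tendsto_zero, ?_⟩)
    filter_upwards [eventually_ge_atTop 0] with s hs using h.nonneg s hs

theorem IsClassKL.nonneg {β : ℝ → ℝ → ℝ} (hβ : IsClassKL β) {r s : ℝ} (hr : 0 ≤ r) (hs : 0 ≤ s) :
    0 ≤ β r s := (hβ.classK s hs).nonneg hr

theorem IsClassKL.antitone {β : ℝ → ℝ → ℝ} (hβ : IsClassKL β) {r s t : ℝ} (hr : 0 ≤ r)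
    (hs : 0 ≤ s) (hst : s ≤ t) : β r t ≤ β r s := by
  rcases hr.eq_or_lt with rfl | hr
  · rw [(hβ.classK s hs).map_zero, (hβ.classK t (hs.trans hst)).map_zero]
  · exact (hβ.classL r hr).strictAntiOn.antitoneOn hs (mem_Ici.2 (hs.trans hst)) hst

theorem isClassKL_exp {a : ℝ} (ha : 0 < a) : IsClassKL (fun r s => Real.exp (-a * s) * r) where
  classK := fun _ _ => IsClassK.id.const_mul (Real.exp_pos _)
  classL := fun r hr => by
    refine ⟨fun s _ => by positivity, by fun_prop, fun x _ y _ hxy => ?_, ?_⟩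
    · exact mul_lt_mul_of_pos_right (Real.exp_lt_exp.2 (by nlinarith)) hr
    · have h : Tendsto (fun s : ℝ => -a * s) atTop atBot :=
        tendsto_id.const_mul_atTop_of_neg (neg_lt_zero.2 ha)
      simpa using (Real.tendsto_exp_atBot.comp h).mul_const r

/-- A family of pairs `(r, y)` such that `y` is small when `r` is small, and at most linear in `r`,
is dominated by a class `K` function. -/
theorem exists_classK_ge {ι : Type*} (r y : ι → ℝ) (hr : ∀ i, 0 ≤ r i)
    (h : ∀ η > 0, ∃ C, ∀ i, y i ≤ η + C * r i) :
    ∃ ω : ℝ → ℝ, IsClassK ω ∧ ∀ i, y i ≤ ω (r i) := by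
  have h' : ∀ η : Ioi (0 : ℝ), ∃ C : ℝ, 0 ≤ C ∧ ∀ i, y i ≤ η + C * r i := by
    rintro ⟨η, hη⟩
    obtain ⟨C, hC⟩ := h η hη
    exact ⟨max C 0, le_max_right _ _, fun i => (hC i).trans
      (add_le_add_right (mul_le_mul_of_nonneg_right (le_max_left _ _) (hr i)) _)⟩
  choose C hC0 hC using h'
  have hne : Nonempty (Ioi (0 : ℝ)) := ⟨⟨1, mem_Ioi.2 one_pos⟩⟩
  -- An infimum of affine functions is concave, hence continuous in the interior; at `0`, continuity
  -- holds because the intercepts `η` are arbitrarily small.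
  set m : ℝ → ℝ := fun x => ⨅ η : Ioi (0 : ℝ), (η : ℝ) + C η * x with hm
  have hterm : ∀ x, 0 ≤ x → ∀ η : Ioi (0 : ℝ), 0 ≤ (η : ℝ) + C η * x := fun x hx η =>
    add_nonneg (le_of_lt η.2) (mul_nonneg (hC0 η) hx)
  have hbdd : ∀ x, 0 ≤ x → BddBelow (range fun η : Ioi (0 : ℝ) => (η : ℝ) + C η * x) :=
    fun x hx => ⟨0, by rintro _ ⟨η, rfl⟩; exact hterm x hx η⟩
  have hle : ∀ x, 0 ≤ x → ∀ η : Ioi (0 : ℝ), m x ≤ η + C η * x := fun x hx η =>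
    ciInf_le (hbdd x hx) η
  have hm0 : ∀ x, 0 ≤ x → 0 ≤ m x := fun x hx => le_ciInf (hterm x hx)
  have hmono : MonotoneOn m (Ici 0) := fun x hx z _ hxz => le_ciInf fun η =>
    (hle x hx η).trans (add_le_add_right (mul_le_mul_of_nonneg_left hxz (hC0 η)) _)
  have hzero : m 0 = 0 := le_antisymm
    (le_of_forall_pos_le_add fun η hη => by simpa using hle 0 le_rfl ⟨η, hη⟩) (hm0 0 le_rfl)
  have hconc : ConcaveOn ℝ (Ici 0) m := by
    refine ⟨convex_Ici 0, fun x hx z hz a b ha hb hab => le_ciInf fun η => ?_⟩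
    have h1 := mul_le_mul_of_nonneg_left (hle x hx η) ha
    have h2 := mul_le_mul_of_nonneg_left (hle z hz η) hb
    simp only [smul_eq_mul]
    calc a * m x + b * m z ≤ (a + b) * η + C η * (a * x + b * z) := by linarith
      _ = _ := by rw [hab, one_mul]
  have hcont : ContinuousOn m (Ici 0) := by
    intro x hx
    rcases (mem_Ici.1 hx).eq_or_lt with rfl | hx
    · rw [ContinuousWithinAt, hzero, Metric.tendsto_nhdsWithin_nhds]
      intro η hη
      have hd : 0 < C ⟨η / 2, half_pos hη⟩ + 1 := by linarith [hC0 ⟨η / 2, half_pos hη⟩]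
      refine ⟨η / 2 / (C ⟨η / 2, half_pos hη⟩ + 1), by positivity, fun x hx hxd => ?_⟩
      rw [Real.dist_eq, sub_zero, abs_of_nonneg hx] at hxd
      rw [Real.dist_eq, sub_zero, abs_of_nonneg (hm0 x hx)]
      rw [lt_div_iff₀ hd] at hxd
      have h1 := hle x hx ⟨η / 2, half_pos hη⟩
      have hx' := mem_Ici.1 hx
      simp only at h1
      nlinarith
    · have := hconc.continuousOn_interior
      rw [interior_Ici] at this
      exact (this.continuousAt (Ioi_mem_nhds hx)).continuousWithinAt
  -- The added `x` makes the monotone `m` strictly increasing.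
  refine ⟨fun x => m x + x, ⟨hcont.add continuousOn_id, fun x hx z hz hxz =>
    add_lt_add_of_le_of_lt (hmono hx hz hxz.le) hxz, by simp [hzero]⟩, fun i => ?_⟩
  have h1 : y i ≤ m (r i) := le_ciInf fun η => hC η i
  linarith [hr i]

/-- A continuous function on a compact set has a class `K` modulus of continuity. -/
theorem _root_.IsCompact.exists_classK_modulus {X Y : Type*} [PseudoMetricSpace X]
    [PseudoMetricSpace Y] {s : Set X} (hs : IsCompact s) {F : X → Y} (hF : ContinuousOn F s) :
    ∃ ω : ℝ → ℝ, IsClassK ω ∧ ∀ x ∈ s, ∀ x' ∈ s, dist (F x) (F x') ≤ ω (dist x x') := by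
  obtain ⟨ω, hω, h⟩ := exists_classK_ge (fun i : s × s => dist i.1 i.2)
    (fun i => dist (F i.1) (F i.2)) (fun _ => dist_nonneg) (by
      intro η hη
      obtain ⟨δ, hδ, hu⟩ := Metric.uniformContinuousOn_iff_le.1
        (hs.uniformContinuousOn_of_continuous hF) η hη
      have hb := (hs.image_of_continuousOn hF).isBounded
      -- Pairs at distance at least `δ` are paid for by the linear term, since the image is bounded.
      refine ⟨Metric.diam (F '' s) / δ, fun ⟨⟨x, hx⟩, ⟨x', hx'⟩⟩ => ?_⟩
      have hq : 0 ≤ Metric.diam (F '' s) / δ := div_nonneg Metric.diam_nonneg hδ.le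
      rcases le_total (dist x x') δ with hd | hd
      · have := hu x hx x' hx' hd
        have := mul_nonneg hq (dist_nonneg (x := x) (y := x'))
        simp only [Subtype.dist_eq]
        linarith
      · have h1 := Metric.dist_le_diam_of_mem hb (mem_image_of_mem F hx) (mem_image_of_mem F hx')
        have h2 := mul_le_mul_of_nonneg_left hd hq
        rw [div_mul_cancel₀ _ hδ.ne'] at h2
        simp only [Subtype.dist_eq]
        linarith)
  exact ⟨ω, hω, fun x hx x' hx' => h (⟨x, hx⟩, ⟨x', hx'⟩)⟩

/-! ### Discrete-time input-to-state stability -/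

/-- The decrease condition `s' ≤ s - κ(s)` is governed by a class `KL` function with the
semigroup property. -/
theorem IsClassK.exists_classKL_semigroup {κ : ℝ → ℝ} (hκ : IsClassK κ) :
    ∃ β : ℝ → ℝ → ℝ, IsClassKL β ∧ (∀ s, 0 ≤ s → β s 0 = s) ∧
      (∀ s t, 0 ≤ s → β (β s t) 1 = β s (t + 1)) ∧
      ∀ s s', 0 ≤ s → s' ≤ s - κ s → s' ≤ β s 1 := by
  -- `β` is the flow of ṡ = -min(κ(s), s). With x = log s, the primitive `P` of `c` decreases at
  -- unit speed along it, so β(s,t) = exp(P⁻¹(P(log s) - t)). The cap by s gives c ≥ 1, so `P` maps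
  -- ℝ onto ℝ and the flow neither reaches `0` nor escapes in finite time, in either time direction.
  set c : ℝ → ℝ := fun x => Real.exp x / min (κ (Real.exp x)) (Real.exp x) with hc
  have hmin : ∀ x, 0 < min (κ (Real.exp x)) (Real.exp x) := fun x =>
    lt_min (hκ.pos (Real.exp_pos x)) (Real.exp_pos x)
  have hκc : Continuous fun x => κ (Real.exp x) := by
    rw [← continuousOn_univ]
    exact hκ.continuousOn.comp Real.continuous_exp.continuousOn fun x _ => (Real.exp_pos x).le
  have hcc : Continuous c :=
    Real.continuous_exp.div (hκc.min Real.continuous_exp) fun x => (hmin x).ne'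
  have hc1 : ∀ x, 1 ≤ c x := fun x => (one_le_div (hmin x)).2 (min_le_right _ _)
  set P : ℝ → ℝ := fun x => ∫ y in (0 : ℝ)..x, c y with hP
  have hPd : ∀ x, HasDerivAt P (c x) x := fun x => hcc.integral_hasStrictDerivAt 0 x |>.hasDerivAt
  have hPmono : StrictMono P := strictMono_of_hasDerivAt_pos hPd fun x =>
    one_pos.trans_le (hc1 x)
  have hPc : Continuous P := continuous_iff_continuousAt.2 fun x => (hPd x).continuousAt
  have hQ : Monotone fun x => P x - x :=
    monotone_of_hasDerivAt_nonneg (fun x => (hPd x).sub (hasDerivAt_id x)) fun x =>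
      sub_nonneg.2 (hc1 x)
  have hP0 : P 0 = 0 := by simp [hP]
  have hPsurj : Function.Surjective P := by
    refine hPc.surjective ?_ ?_
    · refine tendsto_atTop_mono' atTop ?_ tendsto_id
      filter_upwards [eventually_ge_atTop 0] with x hx
      have := hQ hx
      simp only [hP0] at this
      simp only [id_eq]
      linarith
    · refine tendsto_atBot_mono' atBot ?_ tendsto_id
      filter_upwards [eventually_le_atBot 0] with x hx
      have := hQ hx
      simp only [hP0] at this
      simp only [id_eq]
      linarith
  set E : ℝ ≃o ℝ := hPmono.orderIsoOfSurjective P hPsurj with hE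
  have hEP : ∀ x, E x = P x := fun x => rfl
  set β : ℝ → ℝ → ℝ := fun s t =>
    if s ≤ 0 then 0 else Real.exp (E.symm (E (Real.log s) - t)) with hβ
  have hβpos : ∀ s t, 0 < s → β s t = Real.exp (E.symm (E (Real.log s) - t)) := fun s t hs => by
    simp [hβ, not_le.2 hs]
  have hβ0 : ∀ t, β 0 t = 0 := fun t => by simp [hβ]
  have hsemi : ∀ s t t', 0 ≤ s → β (β s t) t' = β s (t + t') := by
    intro s t t' hs
    rcases hs.eq_or_lt with rfl | hs
    · simp [hβ0]
    · rw [hβpos s t hs, hβpos s _ hs, hβpos _ _ (Real.exp_pos _), Real.log_exp,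
        E.apply_symm_apply, sub_sub]
  have hzero : ∀ s, 0 ≤ s → β s 0 = s := by
    intro s hs
    rcases hs.eq_or_lt with rfl | hs
    · exact hβ0 0
    · rw [hβpos s 0 hs, sub_zero, E.symm_apply_apply, Real.exp_log hs]
  have hnn : ∀ s t, 0 ≤ β s t := fun s t => by
    simp only [hβ]; split_ifs
    · exact le_rfl
    · exact (Real.exp_pos _).le
  refine ⟨β, ⟨fun t ht => isClassK_of_surjOn ?_ (hβ0 t) ?_, fun s hs => ⟨fun t _ => hnn s t, ?_,
    ?_, ?_⟩⟩, hzero, fun s t hs => hsemi s t 1 hs, ?_⟩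
  · intro s hs s' hs' hss
    have hs'0 : 0 < s' := lt_of_le_of_lt hs hss
    rcases (mem_Ici.1 hs).eq_or_lt with rfl | hs
    · simp only [hβ0, hβpos s' t hs'0]
      exact Real.exp_pos _
    · simp only [hβpos s' t hs'0, hβpos s t hs]
      refine Real.exp_lt_exp.2 (E.symm.lt_iff_lt.2 (sub_lt_sub_right (E.lt_iff_lt.2 ?_) _))
      exact Real.log_lt_log hs hss
  · intro y hy
    -- The preimage is found by running the flow backwards.
    refine ⟨β y (-t), hnn _ _, ?_⟩
    simp only [hsemi y (-t) t hy, neg_add_cancel, hzero y hy]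
  · simp only [hβpos s _ hs]
    exact (Real.continuous_exp.comp (E.symm.continuous.comp
      (continuous_const.sub continuous_id))).continuousOn
  · intro t _ t' _ htt
    simp only [hβpos s _ hs]
    exact Real.exp_lt_exp.2 (E.symm.lt_iff_lt.2 (sub_lt_sub_left htt _))
  · simp only [hβpos s _ hs]
    refine Real.tendsto_exp_atBot.comp (E.symm.tendsto_atBot.comp ?_)
    exact tendsto_atBot_add_const_left _ _ tendsto_neg_atTop_atBot
  · intro s s' hs h
    rcases le_or_gt s' 0 with hs' | hs'
    · exact hs'.trans (hnn _ _)
    have hs0 : 0 < s := by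
      have := hκ.nonneg hs
      linarith
    have hlog : Real.log s' ≤ Real.log s :=
      Real.log_le_log hs' (by linarith [hκ.nonneg hs])
    set μ := min (κ s) s with hμ
    have hμ0 : 0 < μ := lt_min (hκ.pos hs0) hs0
    -- The flow slows down as it descends: below `s` its speed is at most `μ`, the speed at `s`.
    -- Hence P(log s) - P(log s') ≥ (s - s')/μ ≥ 1, so the flow needs at least unit time to reach
    -- `s'`.
    have hmonoI : MonotoneOn (fun x => P x - Real.exp x / μ) (Icc (Real.log s') (Real.log s)) := by
      have hd : ∀ x, HasDerivAt (fun x => P x - Real.exp x / μ) (c x - Real.exp x / μ) x :=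
        fun x => (hPd x).sub ((Real.hasDerivAt_exp x).div_const μ)
      refine monotoneOn_of_deriv_nonneg (convex_Icc _ _)
        (fun x _ => (hd x).continuousAt.continuousWithinAt)
        (fun x _ => (hd x).differentiableAt.differentiableWithinAt) fun x hx => ?_
      rw [interior_Icc] at hx
      rw [(hd x).deriv, sub_nonneg]
      have hexp : Real.exp x ≤ s := (Real.le_log_iff_exp_le hs0).1 hx.2.le
      exact div_le_div_of_nonneg_left (Real.exp_pos x).le (hmin x)
        (min_le_min (hκ.mono (Real.exp_pos x).le hexp) hexp)
    have hmm := hmonoI (left_mem_Icc.2 hlog) (right_mem_Icc.2 hlog) hlog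
    simp only [Real.exp_log hs', Real.exp_log hs0] at hmm
    have hdiv : 1 ≤ s / μ - s' / μ := by
      rw [← sub_div, one_le_div hμ0]
      exact (min_le_left _ _).trans (by linarith)
    rw [hβpos s 1 hs0, ← Real.log_le_iff_le_exp hs', E.le_symm_apply, hEP, hEP]
    linarith

/-- Half of `κ` drives the decay and half absorbs `r`. If κ(s) > 2r, the step decreases by at least
κ(s)/2; otherwise s ≤ κ⁻¹(2r), and the next value exceeds this by at most `r`. The maximum of the
two bounds is therefore preserved. -/
theorem IsClassKInfty.exists_iss {κ : ℝ → ℝ} (hκ : IsClassKInfty κ) :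
    ∃ (β : ℝ → ℝ → ℝ) (γ : ℝ → ℝ), IsClassKL β ∧ IsClassK γ ∧
      ∀ (r : ℝ), 0 ≤ r → ∀ s : ℕ → ℝ, (∀ k, 0 ≤ s k) →
        (∀ k, s (k + 1) ≤ s k - κ (s k) + r) → ∀ k : ℕ, s k ≤ β (s 0) k + γ r := by
  have hK := hκ.toIsClassK
  have hhalf : IsClassK fun s => 1 / 2 * κ s := hK.const_mul (by norm_num)
  obtain ⟨β, hβ, hβ0, hβ1, hdec⟩ := hhalf.exists_classKL_semigroup
  obtain ⟨ι, hι, hικ, -⟩ := hκ.exists_inverse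
  have h2 : IsClassK fun r : ℝ => 2 * r := IsClassK.id.const_mul two_pos
  refine ⟨β, fun r => ι (2 * r) + r, hβ, (hι.toIsClassK.comp h2).add IsClassK.id, ?_⟩
  intro r hr s hs hstep k
  have hγ : 0 ≤ ι (2 * r) + r := add_nonneg (hι.toIsClassK.nonneg (by linarith)) hr
  have hmain : ∀ k : ℕ, s k ≤ max (β (s 0) k) (ι (2 * r) + r) := by
    intro k
    induction k with
    | zero => simp [hβ0 _ (hs 0)]
    | succ k ih =>
      rcases le_or_gt (κ (s k)) (2 * r) with h | h
      · have h3 := hι.toIsClassK.mono (hK.nonneg (hs k)) h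
        rw [hικ _ (hs k)] at h3
        exact le_max_of_le_right (by linarith [hstep k, hK.nonneg (hs k)])
      · have h3 : s (k + 1) ≤ s k - 1 / 2 * κ (s k) := by linarith [hstep k]
        rcases le_max_iff.1 ih with h4 | h4
        · refine le_max_of_le_left ((hdec _ _ (hs k) h3).trans ?_)
          push_cast
          rw [← hβ1 _ _ (hs 0)]
          exact (hβ.classK 1 zero_le_one).mono (hs k) h4
        · exact le_max_of_le_right (by linarith [hK.nonneg (hs k)])
  have hb := hβ.nonneg (hs 0) (Nat.cast_nonneg k)
  exact (hmain k).trans (max_le (by linarith) (by linarith))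

/-! ### Disturbances over a sampling interval -/

namespace IsDisturbance

variable {n : ℕ} {𝒲 : Set (Vec n)} {w : ℝ → Vec n} {τ : ℝ}

theorem hasDerivWithinAt (hw : IsDisturbance 𝒲 w) {t : ℝ} (ht : 0 ≤ t) :
    HasDerivWithinAt w (dot w t) (Ici 0) t :=
  (hw.contDiffOn.differentiableOn one_ne_zero t ht).hasDerivWithinAt

theorem continuousOn_dot (hw : IsDisturbance 𝒲 w) : ContinuousOn (dot w) (Ici 0) :=
  hw.contDiffOn.continuousOn_derivWithin (uniqueDiffOn_Ici 0) le_rfl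

theorem exists_norm_dot_le (hw : IsDisturbance 𝒲 w) : ∃ M, ∀ t, 0 ≤ t → ‖dot w t‖ ≤ M := by
  obtain ⟨M, hM⟩ := hw.bddAbove
  exact ⟨M, fun t ht => hM ⟨t, ht, rfl⟩⟩

theorem sample_nonneg (hτ : 0 < τ) (k : ℕ) : 0 ≤ (k : ℝ) * τ := by positivity

theorem sample_lt (hτ : 0 < τ) (k : ℕ) : (k : ℝ) * τ < ((k : ℝ) + 1) * τ := by
  nlinarith

theorem ae_norm_dot_le {M : ℝ} (hM : ∀ t, 0 ≤ t → ‖dot w t‖ ≤ M) (hτ : 0 < τ) (k : ℕ) :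
    ∀ᵐ t ∂volume.restrict (Icc ((k : ℝ) * τ) (((k : ℝ) + 1) * τ)), ‖dot w t‖ ≤ M :=
  ae_restrict_of_forall_mem measurableSet_Icc fun t ht => hM t ((sample_nonneg hτ k).trans ht.1)

/-- The continuous functions min(‖ẇ‖, d^k) and ‖ẇ‖ agree almost everywhere on a nondegenerate
interval, hence everywhere on it. -/
theorem norm_dot_le_dSeq (hw : IsDisturbance 𝒲 w) (hτ : 0 < τ) (k : ℕ) {t : ℝ}
    (ht : t ∈ Icc ((k : ℝ) * τ) (((k : ℝ) + 1) * τ)) : ‖dot w t‖ ≤ dSeq w τ k := by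
  obtain ⟨M, hM⟩ := hw.exists_norm_dot_le
  have hae : ∀ᵐ t ∂volume.restrict (Icc ((k : ℝ) * τ) (((k : ℝ) + 1) * τ)),
      ‖dot w t‖ ≤ dSeq w τ k :=
    ae_le_essSup (isBoundedUnder_of_eventually_le (ae_norm_dot_le hM hτ k))
  have hc : ContinuousOn (fun t => ‖dot w t‖) (Icc ((k : ℝ) * τ) (((k : ℝ) + 1) * τ)) :=
    (hw.continuousOn_dot.mono fun t ht => (sample_nonneg hτ k).trans ht.1).norm
  have := Measure.eqOn_Icc_of_ae_eq volume (sample_lt hτ k).ne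
    (f := fun t => min ‖dot w t‖ (dSeq w τ k)) (g := fun t => ‖dot w t‖)
    (hae.mono fun t ht => min_eq_left ht) (hc.inf continuousOn_const) hc ht
  exact min_eq_left_iff.1 this

theorem bddAbove_range_dSeq (hw : IsDisturbance 𝒲 w) (hτ : 0 < τ) :
    BddAbove (range (dSeq w τ)) := by
  obtain ⟨M, hM⟩ := hw.exists_norm_dot_le
  refine ⟨M, ?_⟩
  rintro _ ⟨k, rfl⟩
  have : (ae (volume.restrict (Icc ((k : ℝ) * τ) (((k : ℝ) + 1) * τ)))).NeBot := by
    rw [ae_neBot, Ne, Measure.restrict_eq_zero, Real.volume_Icc]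
    simp [sample_lt hτ k]
  refine limsup_le_of_le ?_ (ae_norm_dot_le hM hτ k)
  exact IsBoundedUnder.isCoboundedUnder_le
    (isBoundedUnder_of_eventually_ge (Eventually.of_forall fun t => norm_nonneg _))

theorem norm_dot_le_iSup (hw : IsDisturbance 𝒲 w) (hτ : 0 < τ) (k : ℕ) {t : ℝ}
    (ht : t ∈ Icc ((k : ℝ) * τ) (((k : ℝ) + 1) * τ)) : ‖dot w t‖ ≤ ⨆ j, dSeq w τ j :=
  (hw.norm_dot_le_dSeq hτ k ht).trans (le_ciSup (hw.bddAbove_range_dSeq hτ) k)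

theorem iSup_dSeq_nonneg (hw : IsDisturbance 𝒲 w) (hτ : 0 < τ) : 0 ≤ ⨆ j, dSeq w τ j :=
  (norm_nonneg _).trans (hw.norm_dot_le_iSup hτ 0 (left_mem_Icc.2 (sample_lt hτ 0).le))

theorem norm_sub_le (hw : IsDisturbance 𝒲 w) (hτ : 0 < τ) (k : ℕ) :
    ‖w (((k : ℝ) + 1) * τ) - w ((k : ℝ) * τ)‖ ≤ τ * ⨆ j, dSeq w τ j := by
  have h := norm_image_sub_le_of_norm_deriv_le_segment' (f := w) (f' := dot w)
    (a := (k : ℝ) * τ) (b := ((k : ℝ) + 1) * τ)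
    (fun t ht => (hw.hasDerivWithinAt ((sample_nonneg hτ k).trans ht.1)).mono
      fun s hs => (sample_nonneg hτ k).trans hs.1)
    (fun t ht => hw.norm_dot_le_iSup hτ k (Ico_subset_Icc_self ht)) _
    (right_mem_Icc.2 (sample_lt hτ k).le)
  calc _ ≤ _ := h
    _ = _ := by ring

/-- The variation of the disturbance over a sampling interval is bounded independently of the
sampling period, provided that the disturbance is slow enough. -/
theorem norm_sub_le_sqrt (hw : IsDisturbance 𝒲 w) (hτ : 0 < τ)
    (hd : (⨆ j, dSeq w τ j) ≤ 1 / τ ^ 2) (k : ℕ) :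
    ‖w (((k : ℝ) + 1) * τ) - w ((k : ℝ) * τ)‖ ≤ Real.sqrt (⨆ j, dSeq w τ j) := by
  -- τd ≤ √d is equivalent to τ²d² ≤ d, which follows from d ≤ 1/τ².
  refine (hw.norm_sub_le hτ k).trans (Real.le_sqrt_of_sq_le ?_)
  have h0 := hw.iSup_dSeq_nonneg hτ
  rw [le_div_iff₀ (by positivity)] at hd
  nlinarith

end IsDisturbance

/-! ### Decay of the plant transient -/

/-- Exponential decay of a local Lyapunov function with a small input. -/
theorem le_exp_of_local_dissipation {v v' : ℝ → ℝ} {a b α σ c : ℝ} (hab : a < b) (hα : 0 < α)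
    (hσ : 0 ≤ σ) (hσc : σ < α * c)
    (hv : ∀ t ∈ Icc a b, HasDerivWithinAt v (v' t) (Icc a b) t)
    (hv' : ∀ t ∈ Icc a b, v t ≤ c → v' t ≤ -α * v t + σ) (ha : v a ≤ c) :
    v b ≤ c ∧ v b ≤ Real.exp (-α * (b - a)) * v a + σ / α := by
  have hc : ContinuousOn v (Icc a b) := fun t ht => (hv t ht).continuousWithinAt
  have hr : ∀ t ∈ Ico a b, HasDerivWithinAt v (v' t) (Ici t) t := fun t ht =>
    (hv t (Ico_subset_Icc_self ht)).mono_of_mem_nhdsWithin (Icc_mem_nhdsGE_of_mem ht)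
  -- Barrier argument: where v = c, the derivative is at most -αc + σ < 0. The dissipation
  -- inequality thus stays valid on the whole interval and Grönwall applies with rate -α.
  have hinv : ∀ ⦃t⦄, t ∈ Icc a b → v t ≤ c :=
    image_le_of_deriv_right_lt_deriv_boundary (B := fun _ => c) (B' := fun _ => 0) hc hr ha
      (fun t => hasDerivAt_const t c) fun t ht hvc => by
        have := hv' t (Ico_subset_Icc_self ht) hvc.le
        rw [hvc] at this
        linarith
  have hb := right_mem_Icc.2 hab.le
  refine ⟨hinv hb, ?_⟩
  have hg := le_gronwallBound_of_liminf_deriv_right_le hc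
    (fun t ht r hr' => (hr t ht).liminf_right_slope_le hr') le_rfl
    (fun t ht => hv' t (Ico_subset_Icc_self ht) (hinv (Ico_subset_Icc_self ht))) b hb
  rw [gronwallBound_of_K_ne_0 (neg_ne_zero.2 hα.ne')] at hg
  have h1 : 0 ≤ σ / α * Real.exp (-α * (b - a)) := by positivity
  calc v b ≤ _ := hg
    _ = Real.exp (-α * (b - a)) * v a + σ / α - σ / α * Real.exp (-α * (b - a)) := by
        rw [div_neg]; ring
    _ ≤ _ := by linarith

namespace Data

variable {nx ny nu nw nz : ℕ} {D : Data nx ny nu nw nz} {V : Vec nx → Vec nu → Vec nw → ℝ}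

/-- The bound σ(d) < α₅εx makes {V ≤ εx} invariant, so the local estimates hold up to time `b`,
where the quadratic lower bound turns energy into distance. -/
theorem IsLISSLyapunov.exists_decay (h : D.IsLISSLyapunov V) :
    ∃ εx > 0, ∃ εw > 0, ∃ α₃ > 0, ∃ α₅ > 0, ∃ σ : ℝ → ℝ, IsClassK σ ∧
      (∀ x, ∀ u ∈ D.𝒰, ∀ w ∈ D.𝒲, V x u w ≤ εx → 0 ≤ V x u w) ∧
      ∀ u ∈ D.𝒰, ∀ w : ℝ → Vec nw, IsDisturbance D.𝒲 w → ∀ a b d : ℝ, 0 ≤ a → a < b →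
        (∀ t ∈ Icc a b, ‖dot w t‖ ≤ d) → d ≤ εw → σ d < α₅ * εx →
        ∀ ξ ξ', D.PlantStep w u a b ξ ξ' → V ξ u (w a) ≤ εx →
          α₃ * ‖ξ' - D.p u (w b)‖ ^ 2 ≤
            Real.exp (-α₅ * (b - a)) * V ξ u (w a) + σ d / α₅ := by
  obtain ⟨hV, εx, hεx, εw, hεw, α₃, hα₃, α₄, hα₄, α₅, hα₅, σ, hσ, hquad, hdiss⟩ := h
  refine ⟨εx, hεx, εw, hεw, α₃, hα₃, α₅, hα₅, σ, hσ, fun x u hu w hw hx =>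
    (by positivity : 0 ≤ α₃ * ‖x - D.p u w‖ ^ 2).trans (hquad x u hu w hw hx).1, ?_⟩
  rintro u hu w hw a b d ha hab hd hdw hσd ξ ξ' ⟨x, hx, rfl, rfl⟩ hξ
  have hpos : ∀ t ∈ Icc a b, 0 ≤ t := fun t ht => ha.trans ht.1
  have hd0 : 0 ≤ d := (norm_nonneg _).trans (hd a (left_mem_Icc.2 hab.le))
  have hdiff : ∀ t ∈ Icc a b, DifferentiableWithinAt ℝ (fun s => V (x s) u (w s)) (Icc a b) t := by
    intro t ht
    have hm : MapsTo (fun s => (x s, u, w s)) (Icc a b) (univ ×ˢ (D.𝒰 ×ˢ D.𝒲)) := fun s hs =>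
      ⟨mem_univ _, hu, hw.mem s (hpos s hs)⟩
    have h1 : DifferentiableWithinAt ℝ (fun s => (x s, u, w s)) (Icc a b) t :=
      (hx t ht).differentiableWithinAt.prodMk ((differentiableWithinAt_const u).prodMk
        ((hw.hasDerivWithinAt (hpos t ht)).differentiableWithinAt.mono hpos))
    exact (hV.differentiableOn one_ne_zero _ (hm ht)).comp t h1 hm
  have hmain := le_exp_of_local_dissipation hab hα₅ (hσ.nonneg hd0) hσd
    (fun t ht => (hdiff t ht).hasDerivWithinAt)
    (fun t ht hvt => (hdiss u hu w hw a b ha hab x hx t ht hvt ((hd t ht).trans hdw)).trans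
      (add_le_add_right (hσ.mono (norm_nonneg _) (hd t ht)) _)) hξ
  exact (hquad _ u hu _ (hw.mem b (ha.trans hab.le)) hmain.1).1.trans hmain.2

end Data

/-! ### One perturbed step of the algorithm -/

namespace Data

variable {nx ny nu nw nz : ℕ} {D : Data nx ny nu nw nz} {V : Vec nx → Vec nu → Vec nw → ℝ}
  {W : Vec nz → Vec nw → ℝ} {ε : ℝ} {zbar : Vec nw → Vec nz}

/-- One perturbed step of the algorithm decreases the merit function, up to class `K` terms in the
perturbation of the iterate and in the variation of the disturbance. -/
theorem AlgorithmAssumption.exists_robust_decrease (halgo : D.AlgorithmAssumption W ε)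
    (hbranch : D.IsBranch zbar) (hcomp : IsCompact D.𝒲) :
    ∃ κ α₁ ωz ω : ℝ → ℝ, ∃ ρ > 0, IsClassKInfty κ ∧ IsClassKInfty α₁ ∧ IsClassK ωz ∧
      IsClassK ω ∧
      (∀ w ∈ D.𝒲, ∀ w' ∈ D.𝒲, ‖zbar w' - zbar w‖ ≤ ωz ‖w' - w‖) ∧
      (∀ w ∈ D.𝒲, ∀ z, ‖z - zbar w‖ ≤ ε → α₁ ‖z - zbar w‖ ≤ W z w) ∧
      ∀ w ∈ D.𝒲, ∀ w' ∈ D.𝒲, ∀ z z', ‖z - zbar w‖ ≤ ρ → ωz ‖w' - w‖ ≤ ρ →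
        ‖z' - D.TT z w'‖ ≤ ρ →
        ‖z' - zbar w'‖ ≤ ε ∧
          W z' w' ≤ W z w - κ (W z w) + (ω ‖z' - D.TT z w'‖ + ω ‖w' - w‖) := by
  obtain ⟨α₁, α₂, α, hα₁, hα₂, hα, hmerit⟩ := halgo.merit
  have hε := halgo.ε_pos
  obtain ⟨ρ₀, hρ₀, hTT⟩ := halgo.TT_continuous_at_solutions (ε / 2) (half_pos hε)
  -- Only distances up to `ε` matter, and the rate `κ` has to be unbounded, as its inverse enters
  -- the scalar comparison.
  obtain ⟨A, hA, hAα⟩ := hα.exists_classKInfty_eqOn hε.le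
  obtain ⟨ι, hι, hια, -⟩ := hα₂.exists_inverse
  obtain ⟨ωz, hωz, hz⟩ := hcomp.exists_classK_modulus hbranch.continuousOn
  set Z := Metric.cthickening ε (zbar '' D.𝒲) with hZ
  have hZc : IsCompact Z := (hcomp.image_of_continuousOn hbranch.continuousOn).cthickening
  have hmemZ : ∀ w ∈ D.𝒲, ∀ z, ‖z - zbar w‖ ≤ ε → z ∈ Z := fun w hw z h =>
    Metric.mem_cthickening_of_dist_le z (zbar w) ε _ (mem_image_of_mem _ hw)
      (by rwa [dist_eq_norm])
  obtain ⟨ωW, hωW, hW⟩ := (hZc.prod hcomp).exists_classK_modulus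
    (halgo.W_continuous.mono (prod_mono_left (subset_univ _)))
  have hAK := hA.toIsClassK
  have hιK := hι.toIsClassK
  -- Halving leaves room for two displacements: `z` is within 2ρ of the new solution, and `z'`
  -- within ρ + ε/2 ≤ ε.
  set ρ := min ρ₀ ε / 2 with hρ
  have hρpos : 0 < ρ := half_pos (lt_min hρ₀ hε)
  have hρ1 : 2 * ρ ≤ ρ₀ := by linarith [min_le_left ρ₀ ε]
  have hρ2 : 2 * ρ ≤ ε := by linarith [min_le_right ρ₀ ε]
  have hz' : ∀ w ∈ D.𝒲, ∀ w' ∈ D.𝒲, ‖zbar w' - zbar w‖ ≤ ωz ‖w' - w‖ := fun w hw w' hw' => by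
    simpa only [dist_eq_norm] using hz w' hw' w hw
  -- The decrease is measured from the new solution, while W(z,w) controls the distance to the old
  -- one. The factor 1/2 offsets the doubling in `apply_add_le` when the shift of the solution is
  -- split off.
  refine ⟨fun s => A (1 / 2 * ι s), α₁, ωz, fun s => ωW s + A (ωz s), ρ, hρpos,
    hA.comp (hι.const_mul one_half_pos), hα₁, hωz, hωW.add (hAK.comp hωz), hz',
    fun w hw z h => (hmerit w hw _ (hbranch.mem w hw) z h).1, ?_⟩
  intro w hw w' hw' z z' hzw hww hzz
  have hvar := hz' w hw w' hw'
  have ha : ‖z - zbar w'‖ ≤ ‖z - zbar w‖ + ‖zbar w' - zbar w‖ := by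
    rw [norm_sub_rev (zbar w')]; exact norm_sub_le_norm_sub_add_norm_sub _ _ _
  have hb : ‖z - zbar w‖ ≤ ‖z - zbar w'‖ + ‖zbar w' - zbar w‖ :=
    norm_sub_le_norm_sub_add_norm_sub _ _ _
  have haε : ‖z - zbar w'‖ ≤ ε := by linarith
  have hTTε := hTT w' hw' _ (hbranch.mem w' hw') z (by linarith)
  have hz'ε : ‖z' - zbar w'‖ ≤ ε := by
    have : ‖z' - zbar w'‖ ≤ ‖z' - D.TT z w'‖ + ‖D.TT z w' - zbar w'‖ :=
      norm_sub_le_norm_sub_add_norm_sub _ _ _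
    linarith
  refine ⟨hz'ε, ?_⟩
  have m1 := hmerit w' hw' _ (hbranch.mem w' hw') z haε
  have m2 := hmerit w hw _ (hbranch.mem w hw) z (by linarith)
  have hWz : W z' w' ≤ W (D.TT z w') w' + ωW ‖z' - D.TT z w'‖ := by
    have := hW (z', w') ⟨hmemZ w' hw' _ hz'ε, hw'⟩ (D.TT z w', w')
      ⟨hmemZ w' hw' _ (by linarith), hw'⟩
    rw [Prod.dist_eq, dist_self, max_eq_left dist_nonneg, dist_eq_norm, dist_eq_norm,
      Real.norm_eq_abs] at this
    linarith [(abs_le.1 this).2]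
  have hWw : W z w' ≤ W z w + ωW ‖w' - w‖ := by
    have := hW (z, w') ⟨hmemZ w' hw' _ haε, hw'⟩ (z, w) ⟨hmemZ w' hw' _ haε, hw⟩
    rw [Prod.dist_eq, dist_self, max_eq_right dist_nonneg, dist_eq_norm, dist_eq_norm,
      Real.norm_eq_abs] at this
    linarith [(abs_le.1 this).2]
  have hW0 : 0 ≤ W z w := (hα₁.toIsClassK.nonneg (norm_nonneg _)).trans m2.1
  have hκ : A (1 / 2 * ι (W z w)) ≤ α ‖z - zbar w'‖ + A (ωz ‖w' - w‖) := by
    rw [← hAα _ ⟨norm_nonneg _, haε⟩]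
    have h1 : ι (W z w) ≤ ‖z - zbar w‖ := by
      have := hιK.mono hW0 m2.2.1
      rwa [hια _ (norm_nonneg _)] at this
    have h0 := hιK.nonneg hW0
    refine (hAK.mono (by positivity)
      (by linarith : 1 / 2 * ι (W z w) ≤ 1 / 2 * ‖z - zbar w'‖ + 1 / 2 * ωz ‖w' - w‖)).trans ?_
    have h2 := hAK.apply_add_le (a := 1 / 2 * ‖z - zbar w'‖) (b := 1 / 2 * ωz ‖w' - w‖)
      (by positivity) (mul_nonneg one_half_pos.le (hωz.nonneg (norm_nonneg _)))
    rwa [← mul_assoc, ← mul_assoc, mul_one_div_cancel two_ne_zero, one_mul, one_mul] at h2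
  have hrest := hAK.nonneg (hωz.nonneg (norm_nonneg (z' - D.TT z w')))
  linarith [m1.2.2]

/-- The plant transient perturbs the algorithm by a class `KL` term in the transient energy and the
sampling period, and a class `K` term in the rate of the disturbance. -/
theorem PlantAssumption.exists_perturbation_bound (hplant : D.PlantAssumption V)
    (hq : ∀ z, D.q z ∈ D.𝒰) {B : Set (Vec nz)} {L : NNReal}
    (hT : ∀ z ∈ B, LipschitzWith L (D.T z)) :
    ∃ (δx : ℝ → ℝ → ℝ) (δd : ℝ → ℝ), IsClassKL δx ∧ IsClassK δd ∧ ∃ εv > 0, ∃ εd > 0,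
      (∀ x, ∀ u ∈ D.𝒰, ∀ w ∈ D.𝒲, V x u w ≤ εv → 0 ≤ V x u w) ∧
      ∀ τ : ℝ, 0 < τ → ∀ w, IsDisturbance D.𝒲 w → (⨆ j, dSeq w τ j) ≤ εd →
        ∀ (k : ℕ), ∀ z ∈ B, ∀ ξ ξ', D.PlantStep w (D.q z) (k * τ) ((k + 1) * τ) ξ ξ' →
          ∀ v, V ξ (D.q z) (w (k * τ)) ≤ v → v ≤ εv →
            ‖D.T z (D.g ξ' (w ((k + 1) * τ))) - D.TT z (w ((k + 1) * τ))‖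
              ≤ δx v τ + δd (⨆ j, dSeq w τ j) := by
  obtain ⟨εx, hεx, εw, hεw, α₃, hα₃, α₅, hα₅, σ, hσ, hVnn, hdecay⟩ := hplant.liss.exists_decay
  obtain ⟨Lg, hg⟩ := hplant.g_lipschitz
  -- Half of α₅εx, so that the barrier condition is strict.
  obtain ⟨ε', hε', hσε⟩ := hσ.exists_pos_le (η := α₅ * εx / 2) (by positivity)
  -- The `+ 1` keeps the gains strictly increasing even if a Lipschitz constant vanishes.
  have hC : (0 : ℝ) < L * Lg + 1 := by positivity
  refine ⟨fun v τ => (L * Lg + 1) * Real.sqrt (1 / α₃ * (Real.exp (-α₅ * τ) * v)),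
    fun d => (L * Lg + 1) * Real.sqrt (1 / (α₃ * α₅) * σ d), ?_, ?_, εx, hεx, min εw ε',
    lt_min hεw hε', hVnn, ?_⟩
  · exact ((IsClassK.sqrt.comp (IsClassK.id.const_mul (one_div_pos.2 hα₃))).const_mul
      hC).comp_classKL (isClassKL_exp hα₅)
  · exact (IsClassK.sqrt.comp (hσ.const_mul (by positivity))).const_mul hC
  intro τ hτ w hw hd k z hz ξ ξ' hstep v hv hvε
  set d := ⨆ j, dSeq w τ j with hd_def
  have hd0 : 0 ≤ d := hw.iSup_dSeq_nonneg hτ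
  have hσd : σ d < α₅ * εx := by
    have := hσ.mono hd0 (hd.trans (min_le_right _ _))
    have : 0 < α₅ * εx := by positivity
    linarith
  have hdec := hdecay _ (hq z) w hw _ _ d (IsDisturbance.sample_nonneg hτ k)
    (IsDisturbance.sample_lt hτ k) (fun t ht => hw.norm_dot_le_iSup hτ k ht)
    (hd.trans (min_le_left _ _)) hσd ξ ξ' hstep (hv.trans hvε)
  have hmemw : w ((k + 1) * τ) ∈ D.𝒲 := hw.mem _ (by positivity)
  have hV0 := hVnn ξ _ (hq z) _ (hw.mem _ (IsDisturbance.sample_nonneg hτ k)) (hv.trans hvε)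
  set P := D.p (D.q z) (w ((k + 1) * τ)) with hP
  have hlip : ‖D.T z (D.g ξ' (w ((k + 1) * τ))) - D.TT z (w ((k + 1) * τ))‖
      ≤ L * Lg * ‖ξ' - P‖ := by
    have h1 := (hT z hz).dist_le_mul (D.g ξ' (w ((k + 1) * τ))) (D.g P (w ((k + 1) * τ)))
    have h2 := hg.dist_le_mul (ξ', w ((k + 1) * τ)) ⟨mem_univ _, hmemw⟩ (P, w ((k + 1) * τ))
      ⟨mem_univ _, hmemw⟩
    rw [Prod.dist_eq, dist_self, max_eq_left dist_nonneg] at h2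
    rw [← dist_eq_norm, ← dist_eq_norm, mul_assoc]
    exact h1.trans (mul_le_mul_of_nonneg_left h2 L.2)
  have hsq : ‖ξ' - P‖ ^ 2 ≤ 1 / α₃ * (Real.exp (-α₅ * τ) * v) + 1 / (α₃ * α₅) * σ d := by
    have h1 : Real.exp (-α₅ * τ) * V ξ (D.q z) (w (k * τ)) ≤ Real.exp (-α₅ * τ) * v :=
      mul_le_mul_of_nonneg_left hv (Real.exp_pos _).le
    rw [show ((k : ℝ) + 1) * τ - k * τ = τ by ring] at hdec
    calc ‖ξ' - P‖ ^ 2 = 1 / α₃ * (α₃ * ‖ξ' - P‖ ^ 2) := by field_simp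
      _ ≤ 1 / α₃ * (Real.exp (-α₅ * τ) * v + σ d / α₅) :=
        mul_le_mul_of_nonneg_left (by linarith) (by positivity)
      _ = _ := by field_simp
  have hnorm : ‖ξ' - P‖ ≤ Real.sqrt (1 / α₃ * (Real.exp (-α₅ * τ) * v)) +
      Real.sqrt (1 / (α₃ * α₅) * σ d) := by
    have hv0 := hV0.trans hv
    have hσ0 := hσ.nonneg hd0
    refine abs_le_of_sq_le_sq' ?_ (by positivity) |>.2
    have h1 := Real.sq_sqrt (show 0 ≤ 1 / α₃ * (Real.exp (-α₅ * τ) * v) by positivity)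
    have h2 := Real.sq_sqrt (show 0 ≤ 1 / (α₃ * α₅) * σ d by positivity)
    have h3 := mul_nonneg (Real.sqrt_nonneg (1 / α₃ * (Real.exp (-α₅ * τ) * v)))
      (Real.sqrt_nonneg (1 / (α₃ * α₅) * σ d))
    nlinarith
  calc _ ≤ L * Lg * ‖ξ' - P‖ := hlip
    _ ≤ (L * Lg + 1) * ‖ξ' - P‖ := by
      nlinarith [norm_nonneg (ξ' - P)]
    _ ≤ _ := by
      rw [← mul_add]
      exact mul_le_mul_of_nonneg_left hnorm hC.le

end Data

end FES

/-! ### Input-output stability of the error dynamics -/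

theorem mainTheorem4 {nx ny nu nw nz : ℕ} (D : FES.Data nx ny nu nw nz)
    (V : FES.Vec nx → FES.Vec nu → FES.Vec nw → ℝ) (W : FES.Vec nz → FES.Vec nw → ℝ) (ε : ℝ)
    (hplant : D.PlantAssumption V) (hreg : D.RegularityAssumption)
    (halgo : D.AlgorithmAssumption W ε)
    (zbar : FES.Vec nw → FES.Vec nz) (hbranch : D.IsBranch zbar) :
    ∃ ε₁ > 0, ∃ ε₂ > 0, ∃ βz βu γzx γux : ℝ → ℝ → ℝ, ∃ γzd γud : ℝ → ℝ,
      FES.IsClassKL βz ∧ FES.IsClassKL βu ∧ FES.IsClassKL γzx ∧ FES.IsClassKL γux ∧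
      FES.IsClassK γzd ∧ FES.IsClassK γud ∧
      ∀ τ : ℝ, 0 < τ → ∃ ε₃ > 0, ∀ w : ℝ → FES.Vec nw, FES.IsDisturbance D.𝒲 w →
        ∀ (e : ℕ → FES.Vec nz) (δx : ℕ → FES.Vec nx) (Δu : ℕ → FES.Vec nu),
          D.IsErrorTrajectory zbar w τ e δx Δu →
          ‖e 0‖ ≤ ε → FES.Data.WSeq W zbar w τ e 0 ≤ ε₁ →
          BddAbove (Set.range (D.VSeq V zbar w τ e δx)) →
          (⨆ k, D.VSeq V zbar w τ e δx k) ≤ ε₂ →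
          (⨆ k, FES.dSeq w τ k) ≤ ε₃ →
          ∀ k : ℕ,
            FES.Data.WSeq W zbar w τ e k ≤ βz (FES.Data.WSeq W zbar w τ e 0) k
              + γzx (⨆ j, D.VSeq V zbar w τ e δx j) τ + γzd (⨆ j, FES.dSeq w τ j) ∧
            ‖Δu k‖ ≤ βu (FES.Data.WSeq W zbar w τ e 0) k
              + γux (⨆ j, D.VSeq V zbar w τ e δx j) τ + γud (⨆ j, FES.dSeq w τ j) := by
  open FES in
  obtain ⟨κ, α₁, ωz, ω, ρ, hρ, hκ, hα₁, hωz, hω, hzmod, hWlow, hdecr⟩ :=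
    halgo.exists_robust_decrease hbranch hplant.disturbances_compact
  have hB : Bornology.IsBounded (Metric.cthickening ε (zbar '' D.𝒲)) :=
    ((hplant.disturbances_compact.image_of_continuousOn hbranch.continuousOn).cthickening).isBounded
  obtain ⟨L, hL⟩ := halgo.T_lipschitz _ hB
  obtain ⟨ηx, ηd, hηx, hηd, εv, hεv, εd, hεd, hVnn, hpert⟩ :=
    hplant.exists_perturbation_bound hreg.q_mem hL
  obtain ⟨Lq, hLq⟩ := hreg.q_lipschitz
  obtain ⟨β, γ, hβ, hγ, hiss⟩ := hκ.exists_iss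
  obtain ⟨ι, hι, hια, -⟩ := hα₁.exists_inverse
  have hκK := hκ.toIsClassK
  have hα₁K := hα₁.toIsClassK
  have hιK := hι.toIsClassK
  have h2ω : IsClassK fun x => ω (2 * x) := hω.comp (IsClassK.id.const_mul two_pos)
  -- W ≤ ε₁ forces |e| ≤ ρ, once |e| ≤ ε is known.
  set ε₁ := α₁ ρ with hε₁
  have hε₁pos : 0 < ε₁ := hα₁K.pos hρ
  -- A perturbation of size at most `θ` keeps W below `ε₁`: if W ≤ ε₁/2 there is room to add it, and
  -- otherwise the decrease κ(ε₁/2) compensates it.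
  set θ := min (ε₁ / 2) (κ (ε₁ / 2)) with hθ
  have hθpos : 0 < θ := lt_min (half_pos hε₁pos) (hκK.pos (half_pos hε₁pos))
  set rx : ℝ → ℝ → ℝ := fun v τ => ω (2 * ηx v τ) with hrx_def
  set rd : ℝ → ℝ := fun d => ω (2 * ηd d) + ω (Real.sqrt d) with hrd_def
  have hrx : IsClassKL rx := h2ω.comp_classKL hηx
  have hrd : IsClassK rd := (h2ω.comp hηd).add (hω.comp IsClassK.sqrt)
  have hωzs : IsClassK fun d => ωz (Real.sqrt d) := hωz.comp IsClassK.sqrt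
  -- Class KL functions are largest at `τ = 0`, so thresholds on ‖V‖ chosen there serve every `τ`.
  have hx0 : IsClassK fun v => ηx v 0 := hηx.classK 0 le_rfl
  have hrx0 : IsClassK fun v => rx v 0 := hrx.classK 0 le_rfl
  obtain ⟨e₁, he₁, he₁'⟩ := hx0.exists_pos_le (half_pos hρ)
  obtain ⟨e₂, he₂, he₂'⟩ := hrx0.exists_pos_le (half_pos hθpos)
  obtain ⟨d₁, hd₁, hd₁'⟩ := hηd.exists_pos_le (half_pos hρ)
  obtain ⟨d₂, hd₂, hd₂'⟩ := hrd.exists_pos_le (half_pos hθpos)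
  obtain ⟨d₃, hd₃, hd₃'⟩ := hωzs.exists_pos_le hρ
  have hγ2 : IsClassK fun r => γ (2 * r) := hγ.comp (IsClassK.id.const_mul two_pos)
  have hq : (0 : ℝ) < Lq + 1 := by positivity
  have hι4 : IsClassK fun r => (Lq + 1) * (2 * ι (4 * r)) :=
    ((hιK.comp (IsClassK.id.const_mul four_pos)).const_mul two_pos).const_mul hq
  have hι2 : IsClassK fun r => 2 * ι (2 * r) :=
    (hιK.comp (IsClassK.id.const_mul two_pos)).const_mul two_pos
  have hγzx : IsClassKL fun v τ => γ (2 * rx v τ) := hγ2.comp_classKL hrx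
  have hγzd : IsClassK fun d => γ (2 * rd d) := hγ2.comp hrd
  -- The inner factors 4, 4, 2 come from splitting `ι` of a three-term sum; the outer 2 counts e^k
  -- and e^{k+1}.
  refine ⟨ε₁, hε₁pos, min εv (min e₁ e₂), by positivity, β,
    fun r s => (Lq + 1) * (2 * ι (4 * β r s)), fun v τ => γ (2 * rx v τ),
    fun v τ => (Lq + 1) * (2 * ι (4 * γ (2 * rx v τ))), fun d => γ (2 * rd d),
    fun d => (Lq + 1) * (2 * ι (2 * γ (2 * rd d)) + ωz (Real.sqrt d)), hβ,
    hι4.comp_classKL hβ, hγzx, hι4.comp_classKL hγzx, hγzd,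
    ((hι2.comp hγzd).add hωzs).const_mul hq, ?_⟩
  intro τ hτ
  refine ⟨min (min εd (1 / τ ^ 2)) (min d₁ (min d₂ d₃)), by positivity, ?_⟩
  intro w hw e δx Δu htraj he0 hW0 hVbdd hVle hdle
  set v := ⨆ j, D.VSeq V zbar w τ e δx j with hv
  set d := ⨆ j, dSeq w τ j with hd
  have hd0 : 0 ≤ d := hw.iSup_dSeq_nonneg hτ
  simp only [le_min_iff] at hVle hdle
  obtain ⟨hv1, hv2, hv3⟩ := hVle
  obtain ⟨⟨hdd, hdτ⟩, hdd1, hdd2, hdd3⟩ := hdle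
  have hVk : ∀ k, D.VSeq V zbar w τ e δx k ≤ v := le_ciSup hVbdd
  have hwm : ∀ k : ℕ, w (k * τ) ∈ D.𝒲 := fun k => hw.mem _ (by positivity)
  -- `V` is known to be nonnegative only on its small sublevel set.
  have hv0 : 0 ≤ v := (hVnn _ _ (hreg.q_mem _) _ (hwm 0) ((hVk 0).trans hv1)).trans (hVk 0)
  have hηxle : ηx v τ ≤ ρ / 2 :=
    (hηx.antitone hv0 le_rfl hτ.le).trans ((hx0.mono hv0 hv2).trans he₁')
  have hrxle : rx v τ ≤ θ / 2 :=
    (hrx.antitone hv0 le_rfl hτ.le).trans ((hrx0.mono hv0 hv3).trans he₂')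
  have hηdle : ηd d ≤ ρ / 2 := (hηd.mono hd0 hdd1).trans hd₁'
  have hrdle : rd d ≤ θ / 2 := (hrd.mono hd0 hdd2).trans hd₂'
  have hωzle : ωz (Real.sqrt d) ≤ ρ := (hωzs.mono hd0 hdd3).trans hd₃'
  have hηx0 := hηx.nonneg hv0 hτ.le
  have hηd0 := hηd.nonneg hd0
  set s := Data.WSeq W zbar w τ e with hs
  have hez : ∀ k : ℕ, Data.zSeq zbar w τ e k - zbar (w (k * τ)) = e k := fun k => by
    simp [Data.zSeq]
  have hlow : ∀ k, ‖e k‖ ≤ ε → α₁ ‖e k‖ ≤ s k := fun k hk => by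
    have := hWlow _ (hwm k) (Data.zSeq zbar w τ e k) (by rwa [hez])
    rwa [hez] at this
  have hvar : ∀ k : ℕ, ‖w ((k + 1) * τ) - w (k * τ)‖ ≤ Real.sqrt d :=
    hw.norm_sub_le_sqrt hτ hdτ
  have hstep : ∀ k, ‖e k‖ ≤ ε → s k ≤ ε₁ →
      ‖e (k + 1)‖ ≤ ε ∧ s (k + 1) ≤ s k - κ (s k) + (rx v τ + rd d) := by
    intro k hk hsk
    obtain ⟨ξ', hplantstep, hek, -⟩ := htraj k
    have hekρ : ‖e k‖ ≤ ρ := hα₁K.le_of_le (norm_nonneg _) hρ.le ((hlow k hk).trans hsk)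
    have hzB : Data.zSeq zbar w τ e k ∈ Metric.cthickening ε (zbar '' D.𝒲) :=
      Metric.mem_cthickening_of_dist_le _ _ ε _ (mem_image_of_mem _ (hwm k))
        (by rwa [dist_eq_norm, hez])
    have hp := hpert τ hτ w hw hdd k _ hzB _ ξ' hplantstep v (hVk k) hv1
    have hwm' := hwm (k + 1)
    push_cast at hwm'
    obtain ⟨h1, h2⟩ := hdecr _ (hwm k) _ hwm' (Data.zSeq zbar w τ e k) _ (by rwa [hez])
      ((hωz.mono (norm_nonneg _) (hvar k)).trans hωzle) (hp.trans (by linarith))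
    rw [← hek] at h1
    refine ⟨h1, ?_⟩
    have hs1 : s (k + 1) = W (D.T (Data.zSeq zbar w τ e k) (D.g ξ' (w ((k + 1) * τ))))
        (w ((k + 1) * τ)) := by
      simp only [hs, Data.WSeq, Data.zSeq, hek]
      push_cast
      simp
    rw [hs1]
    have h3 := (hω.mono (norm_nonneg _) hp).trans (hω.apply_add_le hηx0 hηd0)
    have h4 := hω.mono (norm_nonneg _) (hvar k)
    have hsk' : s k = W (Data.zSeq zbar w τ e k) (w (k * τ)) := rfl
    rw [← hsk'] at h2
    refine h2.trans ?_
    simp only [hrx_def, hrd_def]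
    linarith
  have hinv : ∀ k, ‖e k‖ ≤ ε ∧ s k ≤ ε₁ := by
    intro k
    induction k with
    | zero => exact ⟨he0, hW0⟩
    | succ k ih =>
      obtain ⟨h1, h2⟩ := hstep k ih.1 ih.2
      refine ⟨h1, ?_⟩
      have hsk : 0 ≤ s k := (hα₁K.nonneg (norm_nonneg _)).trans (hlow k ih.1)
      rcases le_total (s k) (ε₁ / 2) with h | h
      · linarith [hκK.nonneg hsk, min_le_left (ε₁ / 2) (κ (ε₁ / 2))]
      · linarith [hκK.mono (half_pos hε₁pos).le h, min_le_right (ε₁ / 2) (κ (ε₁ / 2)), ih.2]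
  have hs0 : ∀ k, 0 ≤ s k := fun k => (hα₁K.nonneg (norm_nonneg _)).trans (hlow k (hinv k).1)
  have hrx0' : 0 ≤ rx v τ := hrx.nonneg hv0 hτ.le
  have hrd0' : 0 ≤ rd d := hrd.nonneg hd0
  have hbound : ∀ k : ℕ, s k ≤ β (s 0) k + γ (2 * rx v τ) + γ (2 * rd d) := fun k => by
    have h1 := hiss _ (add_nonneg hrx0' hrd0') s hs0 (fun k => (hstep k (hinv k).1 (hinv k).2).2) k
    linarith [hγ.apply_add_le hrx0' hrd0']
  intro k
  refine ⟨hbound k, ?_⟩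
  have hβ0 := hβ.nonneg (hs0 0) (Nat.cast_nonneg k)
  have hγx0 := hγzx.nonneg hv0 hτ.le
  have hγd0 := hγzd.nonneg hd0
  -- Stated for all later `j`, so that e^{k+1} gets the same bound in terms of `k` as e^k.
  have herr : ∀ j, k ≤ j → ‖e j‖ ≤ ι (4 * β (s 0) k) + ι (4 * γ (2 * rx v τ)) +
      ι (2 * γ (2 * rd d)) := by
    intro j hj
    have h1 := hιK.mono (hα₁K.nonneg (norm_nonneg _)) (hlow j (hinv j).1)
    rw [hια _ (norm_nonneg _)] at h1
    have h2 := hβ.antitone (hs0 0) (Nat.cast_nonneg k) (Nat.cast_le (α := ℝ).2 hj)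
    have h3 := hιK.mono (hs0 j) ((hbound j).trans (add_le_add_left (add_le_add_left h2 _) _))
    exact h1.trans (h3.trans (hιK.apply_add₃_le hβ0 hγx0 hγd0))
  obtain ⟨ξ', -, hek, hΔ⟩ := htraj k
  set z' := D.T (Data.zSeq zbar w τ e k) (D.g ξ' (w ((k + 1) * τ))) with hz'
  have hwm' := hwm (k + 1)
  push_cast at hwm'
  have hzv : ‖zbar (w ((k + 1) * τ)) - zbar (w (k * τ))‖ ≤ ωz (Real.sqrt d) :=
    (hzmod _ (hwm k) _ hwm').trans (hωz.mono (norm_nonneg _) (hvar k))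
  have hzz : ‖z' - Data.zSeq zbar w τ e k‖ ≤ ‖e (k + 1)‖ + ‖e k‖ + ωz (Real.sqrt d) := by
    have : z' - Data.zSeq zbar w τ e k =
        e (k + 1) - e k + (zbar (w ((k + 1) * τ)) - zbar (w (k * τ))) := by
      rw [hek, Data.zSeq]; abel
    rw [this]
    exact (norm_add_le _ _).trans (add_le_add (norm_sub_le _ _) hzv)
  have hΔle : ‖Δu k‖ ≤ (Lq + 1) * ‖z' - Data.zSeq zbar w τ e k‖ := by
    rw [hΔ]
    have := hLq.norm_sub_le z' (Data.zSeq zbar w τ e k)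
    linarith [norm_nonneg (z' - Data.zSeq zbar w τ e k)]
  refine hΔle.trans ((mul_le_mul_of_nonneg_left (hzz.trans (add_le_add_left (add_le_add
    (herr (k + 1) k.le_succ) (herr k le_rfl)) _)) hq.le).trans (le_of_eq ?_))
  ring
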